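/- **Setting.** An influence graph $G=(V,E,(p_{uv})_{(u,v)\in E})$ is a finite directed graph with an activation probability $p_{uv}\in[0,1]$ on each edge. Its random live-edge graph $L$ contains each edge $(u,v)\in E$ independently with probability $p_{uv}$. For $S\subseteq V$ let $R(S,L)$ be the set of nodes reachable in $L$ from a node of $S$, and let $\sigma(S)=\mathbb E_L[|R(S,L)|]$. For an integer $k\ge 1$ let $OPT_N(G,k)$ be the maximum of $\sigma(S)$ over the sets $S\subseteq V$ with $|S|=k$. A partial realisation is a map $\psi:S\to 2^V$ with $S\subseteq V$ such that, for some live-edge graph $L$, $\psi(v)=R(\{v\},L)$ for all $v\in S$. An adaptive policy $\pi$ (with full-adoption feedback) assigns to each partial realisation either a node or STOP. It is run on a live-edge graph $L$ as follows: start with the empty partial realisation $\psi$; as long as $\pi(\psi)\ne$ STOP, let $v=\pi(\psi)$ and add $(v,R(\{v\},L))$ to $\psi$. Let $\psi_{\pi,L}$ be the partial realisation at the end. We write $|\pi|=k$ if, for every $L$, the run ends and the domain of $\psi_{\pi,L}$ has exactly $k$ elements. The expected influence spread is $\sigma(\pi)=\mathbb E_L\big[\big|\bigcup_{v\in \mathrm{dom}(\psi_{\pi,L})}\psi_{\pi,L}(v)\big|\big]$,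 and $OPT_A(G,k)$ is the maximum of $\sigma(\pi)$ over the policies with $|\pi|=k$. For a class $\mathcal G$ of influence graphs, the $k$-adaptivity gap is $$AG(\mathcal G,k)=\sup_{G\in\mathcal G}\frac{OPT_A(G,k)}{OPT_N(G,k)},$$ where the supremum is over the graphs in $\mathcal G$ with at least $k$ nodes, and the adaptivity gap is $AG(\mathcal G)=\sup_{k\ge1}AG(\mathcal G,k)$. For an integer $\alpha\ge 0$, an influence graph is $\alpha$-bounded if its underlying graph is a simple undirected graph (each undirected edge $\{u,v\}$ stands for the two directed edges $(u,v)$ and $(v,u)$, with possibly distinct probabilities $p_{uv}$ and $p_{vu}$) in which the sum of the degrees of all nodes of degree greater than $2$ is at most $\alpha$. **Theorem 5.1.** For an integer $\alpha\ge 0$ let $\mathcal G_\alpha$ be the class of $\alpha$-bounded influence graphs. Then for all integers $\alpha\ge0$ and $k\ge 2$, $$AG(\mathcal G_\alpha,k)\le\min\left\{k,\ \frac{\alpha}{k}+2+\frac{1}{1-(1-1/k)^k}\right\}\le\frac{\sqrt{4(e-1)^2\alpha+(3e-2)^2}+3e-2}{2(e-1)}.$$ Consequently, for every integer $\alpha\ge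 0$, $$AG(\mathcal G_\alpha)\le\frac{\sqrt{4(e-1)^2\alpha+(3e-2)^2}+3e-2}{2(e-1)},$$ and there is an absolute constant $C$ with $AG(\mathcal G_\alpha)\le\sqrt{\alpha}+C$ for all integers $\alpha\ge 0$. -/

import Mathlib

universe u

/-- An influence graph `G = (V, E, (p_e)_{e ∈ E})`: a finite directed graph together with an
activation probability `p e ∈ [0,1]` for every edge `e`. -/
structure InfluenceGraph : Type (u + 1) where
  V : Type u
  [fintypeV : Fintype V]
  graph : Digraph V
  p : {e : V × V // graph.Adj e.1 e.2} → ℝ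
  p_mem : ∀ e, p e ∈ Set.Icc (0 : ℝ) 1

attribute [instance] InfluenceGraph.fintypeV

noncomputable section

namespace InfluenceGraph

open scoped Classical

/-- The type of (directed) edges of `G`. -/
abbrev Edge (G : InfluenceGraph.{u}) : Type u := {e : G.V × G.V // G.graph.Adj e.1 e.2}

/-- A live-edge graph on `G`, given by its set `L(E) ⊆ E` of live edges. -/
abbrev LiveEdgeGraph (G : InfluenceGraph.{u}) : Type u := Finset G.Edge

/-- The probability that the random live-edge graph is `L`: each edge `e` is live
with probability `p e`, independently of the other edges. -/
def liveProb (G : InfluenceGraph.{u}) (L : G.LiveEdgeGraph) : ℝ :=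
  (∏ e ∈ L, G.p e) * ∏ e ∈ Lᶜ, (1 - G.p e)

/-- The expectation `𝔼_L[X(L)]` over the random live-edge graph `L`. -/
def expect (G : InfluenceGraph.{u}) (X : G.LiveEdgeGraph → ℝ) : ℝ :=
  ∑ L : G.LiveEdgeGraph, G.liveProb L * X L

/-- The set `R(S, L)` of the nodes that are reachable in `L` from some node of `S`. -/
def reach (G : InfluenceGraph.{u}) (S : Finset G.V) (L : G.LiveEdgeGraph) : Finset G.V :=
  Finset.univ.filter fun v => ∃ s ∈ S,
    Relation.ReflTransGen (fun a b => ∃ h : G.graph.Adj a b, (⟨(a, b), h⟩ : G.Edge) ∈ L) s v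

/-- The expected influence spread `σ(S) = 𝔼_L[|R(S, L)|]` of a seed set `S`. -/
def spread (G : InfluenceGraph.{u}) (S : Finset G.V) : ℝ :=
  G.expect fun L => ((G.reach S L).card : ℝ)

/-- `OPT_N(G, k)`: the optimal value of `σ(S)` over the seed sets `S` with `|S| = k`. -/
def optN (G : InfluenceGraph.{u}) (k : ℕ) : ℝ :=
  sSup {x : ℝ | ∃ S : Finset G.V, S.card = k ∧ x = G.spread S}

/-- The realisation `φ_L : V → 2^V` associated to `L`: `φ_L(v) = R({v}, L)`. -/
def realisation (G : InfluenceGraph.{u}) (L : G.LiveEdgeGraph) (v : G.V) : Finset G.V :=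
  G.reach {v} L

/-- A partial realisation: a partial function `ψ` from `V` to `2^V` (`none` means "undefined")
that is a restriction of the realisation `φ_L` of some live-edge graph `L`. -/
def PartialRealisation (G : InfluenceGraph.{u}) : Type u :=
  {ψ : G.V → Option (Finset G.V) //
    ∃ L : G.LiveEdgeGraph, ∀ v, ψ v = none ∨ ψ v = some (G.realisation L v)}

/-- The domain `dom(ψ)`. -/
def PartialRealisation.dom {G : InfluenceGraph.{u}} (ψ : G.PartialRealisation) : Finset G.V :=
  Finset.univ.filter fun v => (ψ.1 v).isSome

/-- `R(ψ) = ⋃_{v ∈ dom(ψ)} ψ(v)`, the set of nodes reached from the seeds in `dom(ψ)`. -/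
def PartialRealisation.reached {G : InfluenceGraph.{u}} (ψ : G.PartialRealisation) :
    Finset G.V :=
  Finset.univ.filter fun w => ∃ v, ∃ A, ψ.1 v = some A ∧ w ∈ A

/-- The restriction of `φ_L` to `S`, i.e. `{(v, R({v}, L)) : v ∈ S}`. -/
def restrict (G : InfluenceGraph.{u}) (L : G.LiveEdgeGraph) (S : Finset G.V) :
    G.PartialRealisation :=
  ⟨fun v => if v ∈ S then some (G.realisation L v) else none, L, fun v => by
    by_cases h : v ∈ S <;> simp [h]⟩

/-- A (deterministic) adaptive policy with full-adoption feedback: given the partial realisation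
observed so far it returns either the next seed node, or `none`, meaning STOP. -/
def Policy (G : InfluenceGraph.{u}) : Type u := G.PartialRealisation → Option G.V

namespace Policy

variable {G : InfluenceGraph.{u}}

/-- The set of nodes that the policy `π` has activated as seeds after `j` rounds of its run on the
live-edge graph `L`. The partial realisation observed at that time is the restriction of `φ_L`
to this set; once the policy says STOP, nothing changes any more. -/
def seeds (π : G.Policy) (L : G.LiveEdgeGraph) : ℕ → Finset G.V
  | 0 => ∅
  | j + 1 =>
    match π (G.restrict L (seeds π L j)) with
    | none => seeds π L j
    | some v => insert v (seeds π L j)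

/-- The partial realisation observed after `j` rounds of the run of `π` on `L`. -/
def observed (π : G.Policy) (L : G.LiveEdgeGraph) (j : ℕ) : G.PartialRealisation :=
  G.restrict L (π.seeds L j)

/-- The run of `π` on `L` reaches STOP. -/
def Halts (π : G.Policy) (L : G.LiveEdgeGraph) : Prop := ∃ j, π (π.observed L j) = none

/-- The partial realisation `ψ_{π,L}` returned by the run of `π` on `L`. A run that reaches STOP
does so after at most `|V|` rounds, see `output_eq_of_eq_none` below. -/
def output (π : G.Policy) (L : G.LiveEdgeGraph) : G.PartialRealisation :=
  π.observed L (Fintype.card G.V)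

/-- `|π| = k`: on every live-edge graph `L` the run of `π` ends, and the partial realisation that
it returns has a domain of cardinality `k`. -/
def HasSize (π : G.Policy) (k : ℕ) : Prop :=
  ∀ L : G.LiveEdgeGraph, π.Halts L ∧ (π.output L).dom.card = k

/-- The expected influence spread `σ(π) = 𝔼_L[|R(ψ_{π,L})|]` of a policy. -/
def spread (π : G.Policy) : ℝ := G.expect fun L => ((π.output L).reached.card : ℝ)

theorem seeds_succ_of_eq_none (π : G.Policy) (L : G.LiveEdgeGraph) {j : ℕ}
    (h : π (π.observed L j) = none) : π.seeds L (j + 1) = π.seeds L j := by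
  have h2 : π (G.restrict L (π.seeds L j)) = none := h
  rw [seeds, h2]

theorem seeds_subset_succ (π : G.Policy) (L : G.LiveEdgeGraph) (j : ℕ) :
    π.seeds L j ⊆ π.seeds L (j + 1) := by
  rw [seeds]
  split
  · exact Finset.Subset.refl _
  · exact Finset.subset_insert _ _

theorem seeds_mono (π : G.Policy) (L : G.LiveEdgeGraph) : Monotone (π.seeds L) :=
  monotone_nat_of_le_succ fun j => π.seeds_subset_succ L j

theorem seeds_const (π : G.Policy) (L : G.LiveEdgeGraph) {j : ℕ}
    (h : π.seeds L (j + 1) = π.seeds L j) (m : ℕ) : π.seeds L (j + m) = π.seeds L j := by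
  induction m with
  | zero => rfl
  | succ m ih =>
    rw [← add_assoc, seeds, ih, ← h]
    conv_rhs => rw [seeds]
    rw [h]

/-- If the run of `π` on `L` stops at round `j`, then the partial realisation observed at that
round is the output. -/
theorem output_eq_of_eq_none (π : G.Policy) (L : G.LiveEdgeGraph) {j : ℕ}
    (h : π (π.observed L j) = none) : π.output L = π.observed L j := by
  suffices hs : π.seeds L (Fintype.card G.V) = π.seeds L j by
    unfold output observed
    rw [hs]
  rcases le_total j (Fintype.card G.V) with hj | hj
  · obtain ⟨m, hm⟩ := Nat.exists_eq_add_of_le hj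
    rw [hm]
    exact π.seeds_const L (π.seeds_succ_of_eq_none L h) m
  · by_cases hex : ∃ i < Fintype.card G.V, π.seeds L (i + 1) = π.seeds L i
    · obtain ⟨i, hi, he⟩ := hex
      obtain ⟨m, hm⟩ := Nat.exists_eq_add_of_le hi.le
      obtain ⟨m', hm'⟩ := Nat.exists_eq_add_of_le (hi.le.trans hj)
      rw [hm, hm', π.seeds_const L he, π.seeds_const L he]
    · push Not at hex
      have hcard : ∀ i ≤ Fintype.card G.V, i ≤ (π.seeds L i).card := by
        intro i
        induction i with
        | zero => simp
        | succ i ih =>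
          intro hi
          have h1 := ih (by omega)
          have h2 : (π.seeds L i).card < (π.seeds L (i + 1)).card :=
            Finset.card_lt_card
              (lt_of_le_of_ne (π.seeds_subset_succ L i) (hex i (by omega)).symm)
          omega
      have huniv : π.seeds L (Fintype.card G.V) = Finset.univ :=
        Finset.eq_univ_of_card _
          (le_antisymm (Finset.card_le_univ _) (hcard _ le_rfl))
      refine le_antisymm (π.seeds_mono L hj) ?_
      rw [huniv]
      exact Finset.subset_univ _

end Policy

/-- `OPT_A(G, k)`: the optimal value of `σ(π)` over the adaptive policies `π` with `|π| = k`. -/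
def optA (G : InfluenceGraph.{u}) (k : ℕ) : ℝ :=
  sSup {x : ℝ | ∃ π : G.Policy, π.HasSize k ∧ x = π.spread}

/-- The class of `α`-bounded influence graphs: the underlying graph is an undirected (simple) graph
`H`, every undirected edge `{u, v}` standing for the two directed edges `(u, v)` and `(v, u)` with
possibly distinct probabilities, and the sum of the node degrees of `H` that are larger than `2`
is at most `α`. -/
def alphaBounded (α : ℕ) : Set InfluenceGraph.{u} :=
  {G | ∃ H : SimpleGraph G.V, (∀ a b, G.graph.Adj a b ↔ H.Adj a b) ∧
    ∑ v ∈ Finset.univ.filter (fun v => 2 < H.degree v), H.degree v ≤ α}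

end InfluenceGraph

/-- The `k`-adaptivity gap `AG(𝒢, k) = sup_{G ∈ 𝒢} OPT_A(G, k) / OPT_N(G, k)`, as an extended
nonnegative real number. The supremum is over the graphs of `𝒢` with at least `k` nodes, those in
which a choice of `k` seed nodes is possible at all. -/
def kAdaptivityGap (𝒢 : Set InfluenceGraph.{u}) (k : ℕ) : ENNReal :=
  ⨆ G : InfluenceGraph.{u}, ⨆ _ : G ∈ 𝒢, ⨆ _ : k ≤ Fintype.card G.V,
    ENNReal.ofReal (G.optA k) / ENNReal.ofReal (G.optN k)

/-- The adaptivity gap `AG(𝒢) = sup_{k ≥ 1} AG(𝒢, k)`. -/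
def adaptivityGap (𝒢 : Set InfluenceGraph.{u}) : ENNReal :=
  ⨆ k : ℕ, ⨆ _ : 1 ≤ k, kAdaptivityGap 𝒢 k

end

/-!
Condition on the set `X = R(S, L)` reached from a seed set `S`. Give the adaptive policy, for free,
`X` and everything reachable from the out-boundary `∂X`. Whatever else it gains is then gained in
`G - X`, where a new seed `v` contributes in expectation at most the marginal gain `σ(v | S)`. Hence
`σ(π) ≤ σ(S) + 𝔼 σ(∂R(S, L)) + k · max_v σ(v | S)`, and the usual greedy recursion shows that
`(1 - (1 - 1/k)^k) (σ(π) - max σ(∂R(S, L))) ≤ OPT_N`. In an `α`-bounded graph every reached node of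
degree `d` replaces itself in the boundary by at most `d - 1` nodes, so `|∂R(S, L)| ≤ 2k + α`, and
averaging over the `k`-subsets of the boundary gives `σ(∂R(S, L)) ≤ (α/k + 2) OPT_N`. The bound
`k` comes from the same inequality with `X = ∅`.
-/

noncomputable section

theorem exists_card_le_mul_le_of_greedy {ι : Type*} [DecidableEq ι] {f : Finset ι → ℝ} {k : ℕ}
    {B : ℝ} (h₀ : 0 ≤ f ∅)
    (h : ∀ S, S.card < k → ∃ v, B ≤ f S + k * (f (insert v S) - f S)) :
    ∃ S, S.card ≤ k ∧ (1 - (1 - 1 / (k : ℝ)) ^ k) * B ≤ f S := by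
  suffices ∀ i ≤ k, ∃ S, S.card ≤ i ∧ (1 - (1 - 1 / (k : ℝ)) ^ i) * B ≤ f S from this k le_rfl
  intro i hi
  induction i with
  | zero => exact ⟨∅, by simp, by simpa using h₀⟩
  | succ i ih =>
    obtain ⟨S, hS, hSB⟩ := ih (by omega)
    obtain ⟨v, hv⟩ := h S (by omega)
    refine ⟨insert v S, (Finset.card_insert_le v S).trans (by omega), ?_⟩
    have hk : (1 : ℝ) ≤ k := by exact_mod_cast (by omega : 1 ≤ k)
    have gain : 1 / (k : ℝ) * (B - f S) ≤ f (insert v S) - f S := by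
      rw [one_div, inv_mul_le_iff₀ (by linarith)]
      linarith
    calc (1 - (1 - 1 / (k : ℝ)) ^ (i + 1)) * B
        = (1 - 1 / (k : ℝ)) * ((1 - (1 - 1 / (k : ℝ)) ^ i) * B) + 1 / (k : ℝ) * B := by ring
      _ ≤ (1 - 1 / (k : ℝ)) * f S + 1 / (k : ℝ) * B := by
        gcongr
        exact sub_nonneg.2 ((div_le_one (by linarith)).2 hk)
      _ ≤ f (insert v S) := by linarith

section Constants

theorem one_sub_exp_neg_one_le {k : ℕ} (hk : 0 < k) :
    1 - Real.exp (-1) ≤ 1 - (1 - 1 / (k : ℝ)) ^ k :=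
  sub_le_sub_left (Real.one_sub_div_pow_le_exp_neg (by exact_mod_cast hk)) 1

theorem one_sub_exp_neg_one_pos : 0 < 1 - Real.exp (-1) :=
  sub_pos.2 (Real.exp_lt_one_iff.2 neg_one_lt_zero)

theorem one_sub_one_sub_one_div_pow_pos {k : ℕ} (hk : 0 < k) :
    0 < 1 - (1 - 1 / (k : ℝ)) ^ k :=
  one_sub_exp_neg_one_pos.trans_le (one_sub_exp_neg_one_le hk)

theorem one_div_one_sub_one_sub_one_div_pow_le {k : ℕ} (hk : 0 < k) :
    1 / (1 - (1 - 1 / (k : ℝ)) ^ k) ≤ Real.exp 1 / (Real.exp 1 - 1) := by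
  calc 1 / (1 - (1 - 1 / (k : ℝ)) ^ k) ≤ 1 / (1 - Real.exp (-1)) :=
        one_div_le_one_div_of_le one_sub_exp_neg_one_pos (one_sub_exp_neg_one_le hk)
    _ = Real.exp 1 / (Real.exp 1 - 1) := by
        rw [← mul_div_mul_left _ _ (Real.exp_ne_zero 1), mul_sub, ← Real.exp_add]
        norm_num

/-- The larger root of `x ^ 2 = c * x + a`. For `a ≥ 0` it is the point where the increasing bound
`x` meets the decreasing bound `a / x + c`. -/
def balancePoint (a c : ℝ) : ℝ :=
  (√(c ^ 2 + 4 * a) + c) / 2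

theorem balancePoint_sq {a : ℝ} (ha : 0 ≤ a) (c : ℝ) :
    balancePoint a c ^ 2 = c * balancePoint a c + a := by
  have := Real.sq_sqrt (by positivity : 0 ≤ c ^ 2 + 4 * a)
  rw [balancePoint]
  linear_combination this / 4

theorem le_balancePoint {a : ℝ} (ha : 0 ≤ a) (c : ℝ) : c ≤ balancePoint a c := by
  have : c ≤ √(c ^ 2 + 4 * a) := Real.le_sqrt_of_sq_le (by linarith)
  rw [balancePoint]
  linarith

theorem min_le_balancePoint {a c x : ℝ} (ha : 0 ≤ a) (hx : 0 < x) :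
    min x (a / x + c) ≤ balancePoint a c := by
  rcases le_total x (balancePoint a c) with h | h
  · exact min_le_of_left_le h
  refine min_le_of_right_le ?_
  rw [div_add' _ _ _ hx.ne', div_le_iff₀ hx]
  nlinarith [mul_nonneg (sub_nonneg.2 (le_balancePoint ha c)) (sub_nonneg.2 h),
    balancePoint_sq ha c]

theorem balancePoint_le_sqrt_add {a c : ℝ} (ha : 0 ≤ a) (hc : 0 ≤ c) :
    balancePoint a c ≤ √a + c := by
  have : √(c ^ 2 + 4 * a) ≤ c + 2 * √a := by
    refine Real.sqrt_le_iff.2 ⟨by positivity, ?_⟩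
    nlinarith [Real.sq_sqrt ha, mul_nonneg hc (Real.sqrt_nonneg a)]
  rw [balancePoint]
  linarith

theorem balancePoint_div (a m : ℝ) {d : ℝ} (hd : 0 < d) :
    balancePoint a (m / d) = (√(4 * d ^ 2 * a + m ^ 2) + m) / (2 * d) := by
  have : (m / d) ^ 2 + 4 * a = (4 * d ^ 2 * a + m ^ 2) / d ^ 2 := by
    field_simp
    ring
  rw [balancePoint, this, Real.sqrt_div' _ (sq_nonneg d), Real.sqrt_sq hd.le]
  field_simp

theorem exp_one_sub_one_pos : 0 < Real.exp 1 - 1 :=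
  sub_pos.2 (Real.one_lt_exp_iff.2 one_pos)

theorem balancePoint_two_add_exp_div (a : ℝ) :
    balancePoint a (2 + Real.exp 1 / (Real.exp 1 - 1)) =
      (√(4 * (Real.exp 1 - 1) ^ 2 * a + (3 * Real.exp 1 - 2) ^ 2) + 3 * Real.exp 1 - 2) /
        (2 * (Real.exp 1 - 1)) := by
  have : 2 + Real.exp 1 / (Real.exp 1 - 1) = (3 * Real.exp 1 - 2) / (Real.exp 1 - 1) := by
    have := exp_one_sub_one_pos.ne'
    field_simp
    ring
  rw [this, balancePoint_div a _ exp_one_sub_one_pos, add_sub_assoc]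

end Constants

namespace InfluenceGraph

open scoped Classical

variable {G : InfluenceGraph.{u}}

section Expectation

theorem liveProb_eq_prod (L : G.LiveEdgeGraph) :
    G.liveProb L = ∏ e, if e ∈ L then G.p e else 1 - G.p e := by
  rw [Finset.prod_ite, Finset.filter_univ_mem, Finset.filter_notMem_eq_sdiff,
    ← Finset.compl_eq_univ_sdiff, liveProb]

theorem liveProb_nonneg (L : G.LiveEdgeGraph) : 0 ≤ G.liveProb L :=
  mul_nonneg (Finset.prod_nonneg fun e _ => (G.p_mem e).1)
    (Finset.prod_nonneg fun e _ => sub_nonneg.2 (G.p_mem e).2)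

theorem sum_liveProb : ∑ L : G.LiveEdgeGraph, G.liveProb L = 1 := by
  simpa [liveProb, Finset.compl_eq_univ_sdiff] using
    (Finset.prod_add G.p (fun e => 1 - G.p e) Finset.univ).symm

theorem expect_const (c : ℝ) : G.expect (fun _ => c) = c := by
  rw [expect, ← Finset.sum_mul, sum_liveProb, one_mul]

theorem expect_mono {X Y : G.LiveEdgeGraph → ℝ} (h : ∀ L, X L ≤ Y L) :
    G.expect X ≤ G.expect Y :=
  Finset.sum_le_sum fun L _ => mul_le_mul_of_nonneg_left (h L) (liveProb_nonneg L)

theorem expect_le {X : G.LiveEdgeGraph → ℝ} {c : ℝ} (h : ∀ L, X L ≤ c) : G.expect X ≤ c :=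
  (expect_mono h).trans_eq (expect_const c)

theorem expect_nonneg {X : G.LiveEdgeGraph → ℝ} (h : ∀ L, 0 ≤ X L) : 0 ≤ G.expect X :=
  Finset.sum_nonneg fun L _ => mul_nonneg (liveProb_nonneg L) (h L)

theorem expect_add (X Y : G.LiveEdgeGraph → ℝ) :
    G.expect (fun L => X L + Y L) = G.expect X + G.expect Y := by
  simp only [expect, mul_add, Finset.sum_add_distrib]

theorem expect_const_mul (c : ℝ) (X : G.LiveEdgeGraph → ℝ) :
    G.expect (fun L => c * X L) = c * G.expect X := by
  simp only [expect, Finset.mul_sum, mul_left_comm]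

theorem expect_sum {ι : Type*} (s : Finset ι) (X : ι → G.LiveEdgeGraph → ℝ) :
    G.expect (fun L => ∑ i ∈ s, X i L) = ∑ i ∈ s, G.expect (X i) := by
  simp only [expect, Finset.mul_sum]
  exact Finset.sum_comm

theorem expect_comm (X : G.LiveEdgeGraph → G.LiveEdgeGraph → ℝ) :
    G.expect (fun L => G.expect (X L)) = G.expect fun L' => G.expect fun L => X L L' := by
  simp only [expect, Finset.mul_sum]
  rw [Finset.sum_comm]
  simp only [mul_left_comm]

/-- The live-edge graph that agrees with `L` on the edges in `A` and with `L'` on the others. -/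
def splice (A : Set G.Edge) (L L' : G.LiveEdgeGraph) : G.LiveEdgeGraph :=
  Finset.univ.filter fun e => if e ∈ A then e ∈ L else e ∈ L'

theorem mem_splice {A : Set G.Edge} {L L' : G.LiveEdgeGraph} {e : G.Edge} :
    e ∈ splice A L L' ↔ if e ∈ A then e ∈ L else e ∈ L' := by
  simp [splice]

theorem splice_splice (A : Set G.Edge) (L L' : G.LiveEdgeGraph) :
    splice A (splice A L L') (splice A L' L) = L := by
  ext e
  by_cases he : e ∈ A <;> simp [mem_splice, he]

theorem liveProb_splice_mul (A : Set G.Edge) (L L' : G.LiveEdgeGraph) :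
    G.liveProb (splice A L L') * G.liveProb (splice A L' L) = G.liveProb L * G.liveProb L' := by
  simp only [liveProb_eq_prod, ← Finset.prod_mul_distrib]
  refine Finset.prod_congr rfl fun e _ => ?_
  by_cases he : e ∈ A <;> simp [mem_splice, he, mul_comm]

/-- Two independent live-edge graphs `L`, `L'` may exchange their states off `A L`, provided that
this exchange does not affect `A L`. -/
theorem expect_expect_splice (A : G.LiveEdgeGraph → Set G.Edge)
    (hA : ∀ L L', A (splice (A L) L L') = A L) (X : G.LiveEdgeGraph → G.LiveEdgeGraph → ℝ) :
    G.expect (fun L => G.expect fun L' => X (splice (A L) L L') (splice (A L) L' L)) =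
      G.expect fun L => G.expect fun L' => X L L' := by
  let swap (x : G.LiveEdgeGraph × G.LiveEdgeGraph) : G.LiveEdgeGraph × G.LiveEdgeGraph :=
    (splice (A x.1) x.1 x.2, splice (A x.1) x.2 x.1)
  have involutive_swap : Function.Involutive swap := fun x => by
    simp only [swap, hA, splice_splice]
  simp only [expect, Finset.mul_sum, ← mul_assoc, ← Fintype.sum_prod_type']
  refine Fintype.sum_bijective swap involutive_swap.bijective _ _ fun x => ?_
  rw [liveProb_splice_mul]

/-- Decoupling: if the edges in `A (Z L)` determine `Z L`, and `F z` depends on the edges outside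
`A z` only, then `L` may be replaced by an independent copy in the second argument of
`F (Z L) L`. -/
theorem expect_decouple {β : Type*} (Z : G.LiveEdgeGraph → β) (A : β → Set G.Edge)
    (F : β → G.LiveEdgeGraph → ℝ)
    (hZ : ∀ L L', (∀ e ∈ A (Z L), e ∈ L ↔ e ∈ L') → Z L' = Z L)
    (hF : ∀ z L L', (∀ e ∉ A z, e ∈ L ↔ e ∈ L') → F z L = F z L') :
    G.expect (fun L => F (Z L) L) = G.expect fun L => G.expect fun L' => F (Z L) L' := by
  have Z_splice (L L') : Z (splice (A (Z L)) L L') = Z L :=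
    hZ _ _ fun e he => by simp [mem_splice, he]
  have F_splice (L L') : F (Z L) (splice (A (Z L)) L' L) = F (Z L) L :=
    hF _ _ _ fun e he => by simp [mem_splice, he]
  rw [← expect_expect_splice (fun L => A (Z L)) fun L L' => by rw [Z_splice]]
  simp only [Z_splice, F_splice, expect_const]

end Expectation

section Reachability

/-- `C` is closed under the live edges of `L`. The reached set `R(S, L)` is the least such set
that contains `S`. -/
def IsLiveClosed (L : G.LiveEdgeGraph) (C : Finset G.V) : Prop :=
  ∀ e ∈ L, e.1.1 ∈ C → e.1.2 ∈ C

theorem IsLiveClosed.union {L : G.LiveEdgeGraph} {C D : Finset G.V} (hC : IsLiveClosed L C)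
    (hD : IsLiveClosed L D) : IsLiveClosed L (C ∪ D) := fun e he h =>
  Finset.mem_union.2 ((Finset.mem_union.1 h).imp (hC e he) (hD e he))

theorem subset_reach (S : Finset G.V) (L : G.LiveEdgeGraph) : S ⊆ G.reach S L := fun s hs =>
  Finset.mem_filter.2 ⟨Finset.mem_univ s, s, hs, Relation.ReflTransGen.refl⟩

theorem isLiveClosed_reach (S : Finset G.V) (L : G.LiveEdgeGraph) :
    IsLiveClosed L (G.reach S L) := by
  intro e he h
  obtain ⟨-, s, hs, hse⟩ := Finset.mem_filter.1 h
  exact Finset.mem_filter.2 ⟨Finset.mem_univ _, s, hs, hse.tail ⟨e.2, he⟩⟩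

theorem reach_subset {S C : Finset G.V} {L : G.LiveEdgeGraph} (hS : S ⊆ C)
    (hC : IsLiveClosed L C) : G.reach S L ⊆ C := by
  intro v hv
  obtain ⟨-, s, hs, hsv⟩ := Finset.mem_filter.1 hv
  clear hv
  induction hsv with
  | refl => exact hS hs
  | tail _ hab ih => exact hC ⟨_, hab.1⟩ hab.2 ih

theorem reach_mono {S T : Finset G.V} {L L' : G.LiveEdgeGraph} (hS : S ⊆ T) (hL : L ⊆ L') :
    G.reach S L ⊆ G.reach T L' :=
  reach_subset (hS.trans (subset_reach T L')) fun e he => isLiveClosed_reach T L' e (hL he)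

theorem reach_mono_left {S T : Finset G.V} (hS : S ⊆ T) (L : G.LiveEdgeGraph) :
    G.reach S L ⊆ G.reach T L :=
  reach_mono hS subset_rfl

theorem reach_eq_biUnion (S : Finset G.V) (L : G.LiveEdgeGraph) :
    G.reach S L = S.biUnion fun s => G.reach {s} L := by
  ext v
  simp [reach]

theorem reach_empty (L : G.LiveEdgeGraph) : G.reach ∅ L = ∅ := by
  rw [reach_eq_biUnion, Finset.biUnion_empty]

theorem reach_union (S T : Finset G.V) (L : G.LiveEdgeGraph) :
    G.reach (S ∪ T) L = G.reach S L ∪ G.reach T L := by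
  rw [reach_eq_biUnion, reach_eq_biUnion S, reach_eq_biUnion T, Finset.union_biUnion]

theorem reach_congr {S : Finset G.V} {L L' : G.LiveEdgeGraph}
    (h : ∀ e : G.Edge, e.1.1 ∈ G.reach S L → (e ∈ L ↔ e ∈ L')) : G.reach S L' = G.reach S L := by
  have hle : G.reach S L' ⊆ G.reach S L :=
    reach_subset (subset_reach S L) fun e he hs => isLiveClosed_reach S L e ((h e hs).2 he) hs
  exact hle.antisymm <| reach_subset (subset_reach S L') fun e he hs =>
    isLiveClosed_reach S L' e ((h e (hle hs)).1 he) hs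

theorem reach_induction {S : Finset G.V} {L : G.LiveEdgeGraph} {P : Finset G.V → Prop}
    (base : P S)
    (insert : ∀ A, ∀ e ∈ L, e.1.1 ∈ A → e.1.2 ∉ A → P A → P (insert e.1.2 A)) :
    P (G.reach S L) := by
  obtain ⟨A, hSA, hA⟩ := (Set.toFinite {A | A ⊆ G.reach S L ∧ P A}).exists_le_maximal
    ⟨subset_reach S L, base⟩
  have closed : IsLiveClosed L A := by
    intro e he heA
    by_contra hw
    have hreach : Insert.insert e.1.2 A ⊆ G.reach S L :=
      Finset.insert_subset (isLiveClosed_reach S L e he (hA.prop.1 heA)) hA.prop.1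
    exact hw (hA.le_of_ge ⟨hreach, insert A e he heA hw hA.prop.2⟩ (Finset.subset_insert _ _)
      (Finset.mem_insert_self _ _))
  rw [(reach_subset hSA closed).antisymm hA.prop.1]
  exact hA.prop.2

/-- The nodes that can be reached in `L` from `S` by walks avoiding `X`: the set `R(S \ X, L - X)`
of the graph `G - X`. -/
def reachAvoiding (X S : Finset G.V) (L : G.LiveEdgeGraph) : Finset G.V :=
  G.reach (S \ X) (L.filter fun e => e.1.2 ∉ X)

theorem reachAvoiding_subset_compl (X S : Finset G.V) (L : G.LiveEdgeGraph) :
    reachAvoiding X S L ⊆ Xᶜ :=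
  reach_subset (by simp [Finset.subset_iff]) fun e he _ =>
    Finset.mem_compl.2 (Finset.mem_filter.1 he).2

theorem disjoint_reachAvoiding (X S : Finset G.V) (L : G.LiveEdgeGraph) :
    Disjoint X (reachAvoiding X S L) :=
  Finset.disjoint_right.2 fun _ hv => Finset.mem_compl.1 (reachAvoiding_subset_compl X S L hv)

theorem reachAvoiding_subset_reach (X S : Finset G.V) (L : G.LiveEdgeGraph) :
    reachAvoiding X S L ⊆ G.reach S L :=
  reach_mono Finset.sdiff_subset (Finset.filter_subset _ _)

theorem reachAvoiding_empty_left (S : Finset G.V) (L : G.LiveEdgeGraph) :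
    reachAvoiding ∅ S L = G.reach S L := by
  simp [reachAvoiding]

theorem reachAvoiding_mono {X Y S T : Finset G.V} (hX : X ⊆ Y) (hS : S \ Y ⊆ T)
    (L : G.LiveEdgeGraph) : reachAvoiding Y S L ⊆ reachAvoiding X T L := by
  refine reach_mono (fun v hv => ?_) (Finset.monotone_filter_right _ fun _ _ he h => he (hX h))
  exact Finset.mem_sdiff.2 ⟨hS hv, fun h => (Finset.mem_sdiff.1 hv).2 (hX h)⟩

theorem card_reachAvoiding_le_sum (X S : Finset G.V) (L : G.LiveEdgeGraph) :
    (reachAvoiding X S L).card ≤ ∑ v ∈ S, (reachAvoiding X {v} L).card := by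
  refine (Finset.card_le_card ?_).trans Finset.card_biUnion_le
  rw [reachAvoiding, reach_eq_biUnion]
  refine Finset.biUnion_subset.2 fun v hv => ?_
  obtain ⟨hvS, hvX⟩ := Finset.mem_sdiff.1 hv
  refine subset_trans ?_ (Finset.subset_biUnion_of_mem _ hvS)
  rw [reachAvoiding, Finset.sdiff_eq_self_of_disjoint (Finset.disjoint_singleton_left.2 hvX)]

theorem reachAvoiding_congr {X S : Finset G.V} {L L' : G.LiveEdgeGraph}
    (h : ∀ e : G.Edge, e.1.1 ∉ X → (e ∈ L ↔ e ∈ L')) :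
    reachAvoiding X S L = reachAvoiding X S L' := by
  refine (reach_congr fun e he => ?_).symm
  simp [h e (Finset.mem_compl.1 (reachAvoiding_subset_compl X S L he))]

theorem reach_subset_union_reachAvoiding {X C : Finset G.V} {L : G.LiveEdgeGraph} (hXC : X ⊆ C)
    (hC : IsLiveClosed L C) (S : Finset G.V) : G.reach S L ⊆ C ∪ reachAvoiding X S L := by
  refine reach_subset (fun s hs => ?_) fun e he h => ?_
  · by_cases hX : s ∈ X
    · exact Finset.mem_union_left _ (hXC hX)
    · exact Finset.mem_union_right _ (subset_reach _ _ (Finset.mem_sdiff.2 ⟨hs, hX⟩))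
  · rcases Finset.mem_union.1 h with h | h
    · exact Finset.mem_union_left _ (hC e he h)
    by_cases hX : e.1.2 ∈ X
    · exact Finset.mem_union_left _ (hXC hX)
    · exact Finset.mem_union_right _
        (isLiveClosed_reach _ _ e (Finset.mem_filter.2 ⟨he, hX⟩) h)

theorem reach_union_eq_union_reachAvoiding (S T : Finset G.V) (L : G.LiveEdgeGraph) :
    G.reach (S ∪ T) L = G.reach S L ∪ reachAvoiding (G.reach S L) T L := by
  rw [reach_union]
  exact (Finset.union_subset Finset.subset_union_left
      (reach_subset_union_reachAvoiding subset_rfl (isLiveClosed_reach S L) T)).antisymm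
    (Finset.union_subset_union_right (reachAvoiding_subset_reach _ T L))

/-- The out-boundary `∂X`: the nodes outside `X` that have an incoming edge from `X`. -/
def outBoundary (X : Finset G.V) : Finset G.V :=
  Finset.univ.filter fun w => w ∉ X ∧ ∃ v ∈ X, G.graph.Adj v w

theorem mem_outBoundary {X : Finset G.V} {w : G.V} :
    w ∈ outBoundary X ↔ w ∉ X ∧ ∃ v ∈ X, G.graph.Adj v w := by
  simp [outBoundary]

theorem outBoundary_empty : outBoundary (∅ : Finset G.V) = ∅ := by
  simp [outBoundary]

/-- What is given away for free when `X` has been activated: `X` and all nodes reachable from its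
out-boundary, whether or not the edges from `X` to the boundary are live. -/
def hull (X : Finset G.V) (L : G.LiveEdgeGraph) : Finset G.V :=
  X ∪ G.reach (outBoundary X) L

theorem isLiveClosed_hull (X : Finset G.V) (L : G.LiveEdgeGraph) : IsLiveClosed L (hull X L) := by
  intro e he h
  by_cases hX : e.1.2 ∈ X
  · exact Finset.mem_union_left _ hX
  refine Finset.mem_union_right _ ?_
  rcases Finset.mem_union.1 h with h | h
  · exact subset_reach _ _ (mem_outBoundary.2 ⟨hX, e.1.1, h, e.2⟩)
  · exact isLiveClosed_reach _ _ e he h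

theorem reach_union_sdiff_hull_subset (X S T : Finset G.V) (L : G.LiveEdgeGraph) :
    G.reach (S ∪ T) L \ hull X L ⊆
      (G.reach S L \ hull X L) ∪ reachAvoiding (X ∪ G.reach S L) T L := by
  have hT : G.reach T L ⊆ hull X L ∪ G.reach S L ∪ reachAvoiding (X ∪ G.reach S L) T L :=
    reach_subset_union_reachAvoiding (Finset.union_subset_union_left Finset.subset_union_left)
      ((isLiveClosed_hull X L).union (isLiveClosed_reach S L)) T
  intro w hw
  have hTw := @hT w
  simp only [reach_union, Finset.mem_sdiff, Finset.mem_union] at hw hTw ⊢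
  tauto

end Reachability

section Spread

theorem spread_mono {S T : Finset G.V} (h : S ⊆ T) : G.spread S ≤ G.spread T :=
  expect_mono fun L => Nat.cast_le.2 (Finset.card_le_card (reach_mono_left h L))

theorem spread_nonneg (S : Finset G.V) : 0 ≤ G.spread S :=
  expect_nonneg fun _ => Nat.cast_nonneg _

theorem spread_empty : G.spread ∅ = 0 := by
  simp [spread, reach_empty, expect_const]

/-- The expected spread of `S` in the graph `G - X`. -/
def spreadAvoiding (X S : Finset G.V) : ℝ :=
  G.expect fun L => ((reachAvoiding X S L).card : ℝ)

theorem spreadAvoiding_empty_left (S : Finset G.V) : spreadAvoiding ∅ S = G.spread S := by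
  simp only [spreadAvoiding, spread, reachAvoiding_empty_left]

theorem spreadAvoiding_mono {X Y S T : Finset G.V} (hX : X ⊆ Y) (hS : S \ Y ⊆ T) :
    spreadAvoiding Y S ≤ spreadAvoiding X T :=
  expect_mono fun L => Nat.cast_le.2 (Finset.card_le_card (reachAvoiding_mono hX hS L))

theorem spreadAvoiding_le_sum (X S : Finset G.V) :
    spreadAvoiding X S ≤ ∑ v ∈ S, spreadAvoiding X {v} := by
  simp only [spreadAvoiding]
  rw [← expect_sum]
  exact expect_mono fun L => by exact_mod_cast card_reachAvoiding_le_sum X S L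

/-- The marginal gain of `T` over `S` is the expected spread of `T` in the graph without the nodes
reached from `S`: revealing `R(S, L)` only reveals edges that leave it. -/
theorem spread_union (S T : Finset G.V) :
    G.spread (S ∪ T) = G.spread S + G.expect fun L => spreadAvoiding (G.reach S L) T := by
  have decouple : G.expect (fun L => ((reachAvoiding (G.reach S L) T L).card : ℝ)) =
      G.expect fun L => spreadAvoiding (G.reach S L) T :=
    expect_decouple (G.reach S) (fun X => {e | e.1.1 ∈ X})
      (fun X L => ((reachAvoiding X T L).card : ℝ)) (fun _ _ => reach_congr)
      fun X L L' h => by rw [reachAvoiding_congr h]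
  rw [← decouple, spread, spread, ← expect_add]
  congr 1 with L
  rw [reach_union_eq_union_reachAvoiding,
    Finset.card_union_of_disjoint (disjoint_reachAvoiding _ T L), Nat.cast_add]

theorem spread_insert (S : Finset G.V) (v : G.V) :
    G.spread (insert v S) =
      G.spread S + G.expect fun L => spreadAvoiding (G.reach S L) {v} := by
  rw [← Finset.union_singleton, spread_union]

theorem optN_nonneg (k : ℕ) : 0 ≤ G.optN k :=
  Real.sSup_nonneg (by rintro _ ⟨S, -, rfl⟩; exact spread_nonneg S)

theorem spread_le_optN {k : ℕ} (hk : k ≤ Fintype.card G.V) {S : Finset G.V} (hS : S.card ≤ k) :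
    G.spread S ≤ G.optN k := by
  obtain ⟨T, hST, hT⟩ := Finset.exists_superset_card_eq hS hk
  have bdd : BddAbove {x | ∃ S : Finset G.V, S.card = k ∧ x = G.spread S} :=
    ⟨G.spread Finset.univ, by rintro _ ⟨S, -, rfl⟩; exact spread_mono S.subset_univ⟩
  exact (spread_mono hST).trans (le_csSup bdd ⟨T, hT, rfl⟩)

theorem choose_mul_card_reach_le {k : ℕ} (hk : 0 < k) (T : Finset G.V) (L : G.LiveEdgeGraph) :
    (T.card - 1).choose (k - 1) * (G.reach T L).card ≤
      ∑ U ∈ T.powersetCard k, (G.reach U L).card := by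
  have many_reach : ∀ w ∈ G.reach T L, (T.card - 1).choose (k - 1) ≤
      ((T.powersetCard k).filter fun U => w ∈ G.reach U L).card := by
    intro w hw
    rw [reach_eq_biUnion, Finset.mem_biUnion] at hw
    obtain ⟨s, hs, hsw⟩ := hw
    have count := Finset.card_filter_powersetCard_subset {s} T k (by simpa using hs) (by simpa)
    rw [Finset.card_singleton] at count
    rw [← count]
    refine Finset.card_le_card (Finset.monotone_filter_right _ fun U _ hsU => ?_)
    exact reach_mono_left hsU L hsw
  calc (T.card - 1).choose (k - 1) * (G.reach T L).card
      ≤ ∑ w ∈ G.reach T L, ((T.powersetCard k).filter fun U => w ∈ G.reach U L).card := by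
        rw [mul_comm, ← smul_eq_mul]
        exact Finset.card_nsmul_le_sum _ _ _ many_reach
    _ = ∑ U ∈ T.powersetCard k, ((G.reach T L).filter fun w => w ∈ G.reach U L).card :=
        Finset.sum_card_bipartiteAbove_eq_sum_card_bipartiteBelow fun w U => w ∈ G.reach U L
    _ ≤ ∑ U ∈ T.powersetCard k, (G.reach U L).card :=
        Finset.sum_le_sum fun U _ => Finset.card_le_card fun _ hw => (Finset.mem_filter.1 hw).2

theorem mul_spread_le_card_mul_optN {k : ℕ} {T : Finset G.V} (hk : k ≤ T.card) :
    k * G.spread T ≤ T.card * G.optN k := by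
  rcases Nat.eq_zero_or_pos k with rfl | hk0
  · simpa using mul_nonneg (Nat.cast_nonneg _) (optN_nonneg 0)
  set c : ℕ := (T.card - 1).choose (k - 1)
  have hc : (0 : ℝ) < c := Nat.cast_pos.2 (Nat.choose_pos (by omega))
  have absorb : (T.card * c : ℝ) = T.card.choose k * k := by
    have := Nat.add_one_mul_choose_eq (T.card - 1) (k - 1)
    rw [Nat.sub_add_cancel (hk0.trans_le hk), Nat.sub_add_cancel hk0] at this
    exact_mod_cast this
  have average : c * G.spread T ≤ T.card.choose k * G.optN k := by
    calc c * G.spread T ≤ ∑ U ∈ T.powersetCard k, G.spread U := by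
          simp only [spread]
          rw [← expect_const_mul, ← expect_sum]
          exact expect_mono fun L => by exact_mod_cast choose_mul_card_reach_le hk0 T L
      _ ≤ (T.powersetCard k).card • G.optN k :=
          Finset.sum_le_card_nsmul _ _ _ fun U hU =>
            spread_le_optN (hk.trans T.card_le_univ) (Finset.mem_powersetCard.1 hU).2.le
      _ = T.card.choose k * G.optN k := by rw [Finset.card_powersetCard, nsmul_eq_mul]
  refine le_of_mul_le_mul_left ?_ hc
  calc c * (k * G.spread T) = k * (c * G.spread T) := by ring
    _ ≤ k * (T.card.choose k * G.optN k) := by gcongr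
    _ = T.card.choose k * k * G.optN k := by ring
    _ = c * (T.card * G.optN k) := by rw [← absorb]; ring

theorem spread_le_max_mul_optN {k : ℕ} (hk0 : 0 < k) (hk : k ≤ Fintype.card G.V)
    (T : Finset G.V) : G.spread T ≤ max 1 (T.card / k : ℝ) * G.optN k := by
  rw [max_mul_of_nonneg _ _ (optN_nonneg k), one_mul, div_mul_eq_mul_div, le_max_iff,
    le_div_iff₀' (Nat.cast_pos.2 hk0)]
  exact (le_total T.card k).imp (spread_le_optN hk) mul_spread_le_card_mul_optN

end Spread

section Policies

theorem dom_restrict (L : G.LiveEdgeGraph) (S : Finset G.V) : (G.restrict L S).dom = S := by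
  ext v
  by_cases hv : v ∈ S <;> simp [PartialRealisation.dom, restrict, hv]

theorem reached_restrict (L : G.LiveEdgeGraph) (S : Finset G.V) :
    (G.restrict L S).reached = G.reach S L := by
  ext w
  simp only [PartialRealisation.reached, restrict, realisation, reach_eq_biUnion S,
    Option.ite_none_right_eq_some, Option.some.injEq, Finset.mem_filter, Finset.mem_univ, true_and,
    Finset.mem_biUnion]
  exact exists_congr fun v => ⟨by rintro ⟨_, ⟨hv, rfl⟩, hw⟩; exact ⟨hv, hw⟩,
    fun ⟨hv, hw⟩ => ⟨_, ⟨hv, rfl⟩, hw⟩⟩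

theorem restrict_congr {S : Finset G.V} {L L' : G.LiveEdgeGraph}
    (h : ∀ e : G.Edge, e.1.1 ∈ G.reach S L → (e ∈ L ↔ e ∈ L')) :
    G.restrict L' S = G.restrict L S := by
  refine Subtype.ext (funext fun v => ?_)
  by_cases hv : v ∈ S
  · simp only [restrict, realisation, if_pos hv, Option.some.injEq]
    exact reach_congr fun e he => h e (reach_mono_left (Finset.singleton_subset_iff.2 hv) L he)
  · simp only [restrict, if_neg hv]

namespace Policy

theorem reached_observed (π : G.Policy) (L : G.LiveEdgeGraph) (j : ℕ) :
    (π.observed L j).reached = G.reach (π.seeds L j) L :=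
  reached_restrict L _

theorem seeds_succ (π : G.Policy) (L : G.LiveEdgeGraph) (j : ℕ) :
    π.seeds L (j + 1) = π.seeds L j ∪ (π (π.observed L j)).toFinset := by
  rw [seeds, observed]
  cases π (G.restrict L (π.seeds L j)) <;> simp

theorem observed_congr (π : G.Policy) {L L' : G.LiveEdgeGraph} {j : ℕ}
    (h : ∀ e : G.Edge, e.1.1 ∈ G.reach (π.seeds L j) L → (e ∈ L ↔ e ∈ L')) :
    π.observed L' j = π.observed L j := by
  have seeds_eq : ∀ i ≤ j, π.seeds L' i = π.seeds L i := by
    intro i hi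
    induction i with
    | zero => rfl
    | succ i ih =>
      have restrict_eq : G.restrict L' (π.seeds L i) = G.restrict L (π.seeds L i) :=
        restrict_congr fun e he => h e (reach_mono_left (π.seeds_mono L (by omega)) L he)
      rw [seeds, seeds, ih (by omega), restrict_eq]
  rw [observed, observed, seeds_eq j le_rfl, restrict_congr h]

/-- The observation before a round only depends on edges that leave the nodes reached so far, so
the gain of that round has the same expectation in an independent live-edge graph. -/
theorem expect_card_reachAvoiding_next (π : G.Policy) (X : Finset G.V) (j : ℕ) :
    G.expect (fun L => ((reachAvoiding (X ∪ G.reach (π.seeds L j) L)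
        (π (π.observed L j)).toFinset L).card : ℝ)) =
      G.expect fun L => spreadAvoiding (X ∪ G.reach (π.seeds L j) L)
        (π (π.observed L j)).toFinset := by
  have decouple := expect_decouple (π.observed · j) (fun ψ => {e | e.1.1 ∈ ψ.reached})
    (fun ψ L => ((reachAvoiding (X ∪ ψ.reached) (π ψ).toFinset L).card : ℝ))
    (fun L L' h => π.observed_congr fun e he => h e (by rwa [← reached_observed] at he))
    fun ψ L L' h => by
      rw [reachAvoiding_congr fun e he => h e fun hψ => he (Finset.mem_union_right X hψ)]
  simpa only [reached_observed, spreadAvoiding] using decouple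

theorem expect_card_reach_sdiff_hull_le (π : G.Policy) (X : Finset G.V) (j : ℕ) :
    G.expect (fun L => ((G.reach (π.seeds L j) L \ hull X L).card : ℝ)) ≤
      G.expect fun L => ∑ v ∈ π.seeds L j, spreadAvoiding X {v} := by
  induction j with
  | zero => simp [seeds, reach_empty]
  | succ j ih =>
    have next_le (L) : spreadAvoiding (X ∪ G.reach (π.seeds L j) L) (π (π.observed L j)).toFinset ≤
        ∑ v ∈ (π (π.observed L j)).toFinset \ π.seeds L j, spreadAvoiding X {v} :=
      (spreadAvoiding_mono Finset.subset_union_left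
        (Finset.sdiff_subset_sdiff subset_rfl
          ((subset_reach _ L).trans Finset.subset_union_right))).trans
        (spreadAvoiding_le_sum X _)
    calc G.expect (fun L => ((G.reach (π.seeds L (j + 1)) L \ hull X L).card : ℝ))
        ≤ G.expect fun L => ((G.reach (π.seeds L j) L \ hull X L).card : ℝ) +
            (reachAvoiding (X ∪ G.reach (π.seeds L j) L) (π (π.observed L j)).toFinset L).card := by
          refine expect_mono fun L => ?_
          rw [seeds_succ]
          exact_mod_cast (Finset.card_le_card (reach_union_sdiff_hull_subset X _ _ L)).trans
            (Finset.card_union_le _ _)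
      _ = G.expect (fun L => ((G.reach (π.seeds L j) L \ hull X L).card : ℝ)) +
            G.expect fun L => spreadAvoiding (X ∪ G.reach (π.seeds L j) L)
              (π (π.observed L j)).toFinset := by
          rw [expect_add, expect_card_reachAvoiding_next]
      _ ≤ G.expect (fun L => ∑ v ∈ π.seeds L j, spreadAvoiding X {v}) +
            G.expect fun L => ∑ v ∈ (π (π.observed L j)).toFinset \ π.seeds L j,
              spreadAvoiding X {v} :=
          add_le_add ih (expect_mono next_le)
      _ = G.expect fun L => ∑ v ∈ π.seeds L (j + 1), spreadAvoiding X {v} := by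
          simp only [← expect_add, seeds_succ, ← Finset.sum_union Finset.disjoint_sdiff,
            Finset.union_sdiff_self_eq_union]

theorem spread_eq_expect_card_reach (π : G.Policy) :
    π.spread = G.expect fun L => ((G.reach (π.seeds L (Fintype.card G.V)) L).card : ℝ) := by
  simp only [spread, output, reached_observed]

theorem spread_le_add_expect_sum (π : G.Policy) (X : Finset G.V) :
    π.spread ≤ X.card + G.spread (outBoundary X) +
      G.expect fun L => ∑ v ∈ π.seeds L (Fintype.card G.V), spreadAvoiding X {v} := by
  have split (L : G.LiveEdgeGraph) (S : Finset G.V) : (G.reach S L).card ≤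
      X.card + (G.reach (outBoundary X) L).card + (G.reach S L \ hull X L).card := by
    have h₁ : (G.reach S L).card ≤ (G.reach S L \ hull X L).card + (hull X L).card :=
      Finset.card_le_card_sdiff_add_card
    have h₂ : (hull X L).card ≤ _ := Finset.card_union_le X (G.reach (outBoundary X) L)
    omega
  calc π.spread ≤ G.expect fun L => X.card + ((G.reach (outBoundary X) L).card : ℝ) +
        (G.reach (π.seeds L (Fintype.card G.V)) L \ hull X L).card := by
        rw [spread_eq_expect_card_reach]
        exact expect_mono fun L => by exact_mod_cast split L _
    _ = X.card + G.spread (outBoundary X) +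
        G.expect fun L => ((G.reach (π.seeds L (Fintype.card G.V)) L \ hull X L).card : ℝ) := by
        rw [expect_add, expect_add, expect_const, InfluenceGraph.spread]
    _ ≤ _ := by gcongr; exact π.expect_card_reach_sdiff_hull_le X _

namespace HasSize

variable {π : G.Policy} {k : ℕ}

theorem card_seeds (hπ : π.HasSize k) (L : G.LiveEdgeGraph) :
    (π.seeds L (Fintype.card G.V)).card = k := by
  simpa only [output, observed, dom_restrict] using (hπ L).2

theorem le_card (hπ : π.HasSize k) : k ≤ Fintype.card G.V :=
  hπ.card_seeds ∅ ▸ Finset.card_le_univ _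

theorem sum_seeds_le (hπ : π.HasSize k) (L : G.LiveEdgeGraph) {f : G.V → ℝ} {c : ℝ}
    (hf : ∀ v ∈ π.seeds L (Fintype.card G.V), f v ≤ c) :
    ∑ v ∈ π.seeds L (Fintype.card G.V), f v ≤ k * c := by
  rw [← hπ.card_seeds L, ← nsmul_eq_mul]
  exact Finset.sum_le_card_nsmul _ _ _ hf

theorem spread_le_mul_optN (hπ : π.HasSize k) : π.spread ≤ k * G.optN k := by
  have seeds_spread_le (L) : ∀ v ∈ π.seeds L (Fintype.card G.V), G.spread {v} ≤ G.optN k := by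
    intro v hv
    refine spread_le_optN hπ.le_card ?_
    rw [← hπ.card_seeds L]
    exact Finset.card_le_card (Finset.singleton_subset_iff.2 hv)
  have := π.spread_le_add_expect_sum ∅
  simp only [outBoundary_empty, spread_empty, Finset.card_empty, Nat.cast_zero, zero_add,
    spreadAvoiding_empty_left] at this
  exact this.trans (expect_le fun L => hπ.sum_seeds_le L (seeds_spread_le L))

theorem exists_spread_le_add_mul_gain [Nonempty G.V] (hπ : π.HasSize k) (S : Finset G.V) {B : ℝ}
    (hB : ∀ L, G.spread (outBoundary (G.reach S L)) ≤ B) :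
    ∃ v, π.spread ≤ G.spread S + B + k * (G.spread (insert v S) - G.spread S) := by
  obtain ⟨v, hv⟩ := Finite.exists_max fun v => G.spread (insert v S)
  refine ⟨v, ?_⟩
  have average : π.spread ≤ G.expect fun L => (G.reach S L).card + B +
      G.expect fun L' => ∑ w ∈ π.seeds L' (Fintype.card G.V),
        spreadAvoiding (G.reach S L) {w} := by
    rw [← expect_const (G := G) π.spread]
    refine expect_mono fun L => (π.spread_le_add_expect_sum (G.reach S L)).trans ?_
    gcongr
    exact hB L
  rw [expect_add, expect_add, expect_const, expect_comm] at average
  refine average.trans (add_le_add_right (expect_le fun L' => ?_) _)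
  rw [expect_sum]
  refine hπ.sum_seeds_le L' fun w _ => ?_
  rw [le_sub_iff_add_le', ← spread_insert]
  exact hv w

end HasSize

end Policy

theorem optA_le {k : ℕ} {c : ℝ} (hc : 0 ≤ c) (h : ∀ π : G.Policy, π.HasSize k → π.spread ≤ c) :
    G.optA k ≤ c :=
  Real.sSup_le (by rintro _ ⟨π, hπ, rfl⟩; exact h π hπ) hc

theorem optA_le_mul_optN (k : ℕ) : G.optA k ≤ k * G.optN k :=
  optA_le (mul_nonneg k.cast_nonneg (optN_nonneg k)) fun _ hπ => hπ.spread_le_mul_optN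

theorem optA_le_of_card_outBoundary_le {k b : ℕ} (hk : 0 < k)
    (hb : ∀ (S : Finset G.V) L, S.card < k → (outBoundary (G.reach S L)).card ≤ b) :
    G.optA k ≤ (max 1 (b / k : ℝ) + 1 / (1 - (1 - 1 / (k : ℝ)) ^ k)) * G.optN k := by
  have hpos := one_sub_one_sub_one_div_pow_pos hk
  refine optA_le (mul_nonneg (by positivity) (optN_nonneg k)) fun π hπ => ?_
  have : Nonempty G.V := Fintype.card_pos_iff.1 (hk.trans_le hπ.le_card)
  have boundary_le (S : Finset G.V) (hS : S.card < k) (L : G.LiveEdgeGraph) :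
      G.spread (outBoundary (G.reach S L)) ≤ max 1 (b / k : ℝ) * G.optN k := by
    refine (spread_le_max_mul_optN hk hπ.le_card _).trans
      (mul_le_mul_of_nonneg_right ?_ (optN_nonneg k))
    gcongr
    exact hb S L hS
  obtain ⟨S, hS, greedy⟩ := exists_card_le_mul_le_of_greedy (f := G.spread) (k := k)
    (B := π.spread - max 1 (b / k : ℝ) * G.optN k) (spread_nonneg ∅) fun S hS =>
      (hπ.exists_spread_le_add_mul_gain S (boundary_le S hS)).imp fun v hv => by linarith
  have gap := greedy.trans (spread_le_optN hπ.le_card hS)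
  rw [← le_div_iff₀' hpos] at gap
  rw [add_mul, one_div_mul_eq_div]
  linarith

end Policies

section Boundary

variable {H : SimpleGraph G.V}

theorem card_outBoundary_insert (hH : ∀ a b, G.graph.Adj a b → H.Adj a b) {A : Finset G.V}
    {a w : G.V} (ha : a ∈ A) (hw : w ∉ A) (haw : G.graph.Adj a w) :
    (outBoundary (insert w A)).card + 2 ≤ (outBoundary A).card + H.degree w := by
  have mem_boundary : w ∈ outBoundary A := mem_outBoundary.2 ⟨hw, a, ha, haw⟩
  have mem_neighbors : a ∈ H.neighborFinset w := (H.mem_neighborFinset w a).2 (hH a w haw).symm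
  have boundary_subset : outBoundary (insert w A) ⊆
      (outBoundary A).erase w ∪ (H.neighborFinset w).erase a := by
    intro x hx
    simp only [mem_outBoundary, Finset.mem_insert, not_or, Finset.mem_union, Finset.mem_erase,
      SimpleGraph.mem_neighborFinset] at hx ⊢
    obtain ⟨⟨hxw, hxA⟩, v, rfl | hv, hvx⟩ := hx
    · exact Or.inr ⟨fun h => hxA (h ▸ ha), hH _ _ hvx⟩
    · exact Or.inl ⟨hxw, hxA, v, hv, hvx⟩
  have card_le := (Finset.card_le_card boundary_subset).trans (Finset.card_union_le _ _)
  have card_boundary := Finset.card_erase_add_one mem_boundary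
  have card_neighbors := Finset.card_erase_add_one mem_neighbors
  rw [H.card_neighborFinset_eq_degree] at card_neighbors
  omega

theorem card_outBoundary_le_sum_degree (hH : ∀ a b, G.graph.Adj a b → H.Adj a b)
    (S : Finset G.V) :
    (outBoundary S).card ≤ ∑ v ∈ S, H.degree v := by
  refine (Finset.card_le_card fun x hx => ?_).trans
    (Finset.card_biUnion_le (s := S) (t := fun v => H.neighborFinset v))
  obtain ⟨-, v, hv, hvx⟩ := mem_outBoundary.1 hx
  exact Finset.mem_biUnion.2 ⟨v, hv, (H.mem_neighborFinset v x).2 (hH v x hvx)⟩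

theorem card_outBoundary_reach_le (hH : ∀ a b, G.graph.Adj a b → H.Adj a b) (S : Finset G.V)
    (L : G.LiveEdgeGraph) :
    (outBoundary (G.reach S L)).card ≤ 2 * S.card + ∑ v ∈ G.reach S L, (H.degree v - 2) := by
  refine reach_induction (P := fun A => (outBoundary A).card ≤
    2 * S.card + ∑ v ∈ A, (H.degree v - 2)) ?_ fun A e _ ha hw ih => ?_
  · calc (outBoundary S).card ≤ ∑ v ∈ S, H.degree v := card_outBoundary_le_sum_degree hH S
      _ ≤ ∑ v ∈ S, (2 + (H.degree v - 2)) := Finset.sum_le_sum fun v _ => le_add_tsub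
      _ = 2 * S.card + ∑ v ∈ S, (H.degree v - 2) := by
        rw [Finset.sum_add_distrib, Finset.sum_const, smul_eq_mul, mul_comm]
  · have := card_outBoundary_insert hH ha hw e.2
    rw [Finset.sum_insert hw]
    omega

end Boundary

theorem card_outBoundary_reach_le_of_alphaBounded {α : ℕ} (hG : G ∈ alphaBounded.{u} α)
    (S : Finset G.V) (L : G.LiveEdgeGraph) :
    (outBoundary (G.reach S L)).card ≤ 2 * S.card + α := by
  obtain ⟨H, hH, hα⟩ := hG
  refine (card_outBoundary_reach_le (fun a b => (hH a b).1) S L).trans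
    (Nat.add_le_add_left (le_trans ?_ hα) _)
  calc ∑ v ∈ G.reach S L, (H.degree v - 2) ≤ ∑ v, (H.degree v - 2) :=
        Finset.sum_le_sum_of_subset (Finset.subset_univ _)
    _ ≤ ∑ v, if 2 < H.degree v then H.degree v else 0 :=
        Finset.sum_le_sum fun v _ => by split_ifs <;> omega
    _ = ∑ v ∈ Finset.univ.filter (fun v => 2 < H.degree v), H.degree v :=
        (Finset.sum_filter _ _).symm

theorem optA_le_mul_optN_of_alphaBounded {α k : ℕ} (hk : 0 < k) (hG : G ∈ alphaBounded.{u} α) :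
    G.optA k ≤ min (k : ℝ) (α / k + 2 + 1 / (1 - (1 - 1 / (k : ℝ)) ^ k)) * G.optN k := by
  have hk' : (k : ℝ) ≠ 0 := Nat.cast_ne_zero.2 hk.ne'
  have boundary_ratio : max 1 (((2 * k + α : ℕ) : ℝ) / k) = α / k + 2 := by
    rw [Nat.cast_add, Nat.cast_mul, add_div, mul_div_cancel_right₀ _ hk', add_comm, Nat.cast_ofNat]
    exact max_eq_right (by linarith [show (0 : ℝ) ≤ α / k by positivity])
  rw [min_mul_of_nonneg _ _ (optN_nonneg k), ← boundary_ratio]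
  refine le_min (optA_le_mul_optN k) (optA_le_of_card_outBoundary_le hk fun S L hS => ?_)
  exact (card_outBoundary_reach_le_of_alphaBounded hG S L).trans (by omega)

end InfluenceGraph

theorem kAdaptivityGap_le_ofReal {𝒢 : Set InfluenceGraph.{u}} {k : ℕ} {c : ℝ} (hc : 0 ≤ c)
    (h : ∀ G ∈ 𝒢, G.optA k ≤ c * G.optN k) : kAdaptivityGap 𝒢 k ≤ ENNReal.ofReal c := by
  refine iSup_le fun G => iSup_le fun hG => iSup_le fun _ => ENNReal.div_le_of_le_mul ?_
  rw [← ENNReal.ofReal_mul hc]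
  exact ENNReal.ofReal_le_ofReal (h G hG)

theorem kAdaptivityGap_alphaBounded_le (α : ℕ) {k : ℕ} (hk : 0 < k) :
    kAdaptivityGap (InfluenceGraph.alphaBounded.{u} α) k ≤ ENNReal.ofReal
      (min (k : ℝ) (α / k + 2 + 1 / (1 - (1 - 1 / (k : ℝ)) ^ k))) := by
  have := one_sub_one_sub_one_div_pow_pos hk
  exact kAdaptivityGap_le_ofReal (by positivity) fun G hG =>
    InfluenceGraph.optA_le_mul_optN_of_alphaBounded hk hG

theorem min_le_balancePoint_two_add_exp_div {k : ℕ} (hk : 0 < k) {a : ℝ} (ha : 0 ≤ a) :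
    min (k : ℝ) (a / k + 2 + 1 / (1 - (1 - 1 / (k : ℝ)) ^ k)) ≤
      balancePoint a (2 + Real.exp 1 / (Real.exp 1 - 1)) := by
  refine le_trans ?_ (min_le_balancePoint ha (Nat.cast_pos.2 hk))
  rw [add_assoc]
  gcongr min _ (_ + (2 + ?_))
  exact one_div_one_sub_one_sub_one_div_pow_le hk

theorem adaptivityGap_alphaBounded_le (α : ℕ) :
    adaptivityGap (InfluenceGraph.alphaBounded.{u} α) ≤
      ENNReal.ofReal (balancePoint α (2 + Real.exp 1 / (Real.exp 1 - 1))) :=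
  iSup_le fun _ => iSup_le fun hk => (kAdaptivityGap_alphaBounded_le α hk).trans
    (ENNReal.ofReal_le_ofReal (min_le_balancePoint_two_add_exp_div hk α.cast_nonneg))

end

theorem theorem5p1 :
    (∀ α k : ℕ, 2 ≤ k →
      kAdaptivityGap (InfluenceGraph.alphaBounded.{u} α) k ≤
          ENNReal.ofReal (min (k : ℝ)
            ((α : ℝ) / (k : ℝ) + 2 + 1 / (1 - (1 - 1 / (k : ℝ)) ^ k))) ∧
        min (k : ℝ) ((α : ℝ) / (k : ℝ) + 2 + 1 / (1 - (1 - 1 / (k : ℝ)) ^ k)) ≤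
          (Real.sqrt (4 * (Real.exp 1 - 1) ^ 2 * (α : ℝ) + (3 * Real.exp 1 - 2) ^ 2)
            + 3 * Real.exp 1 - 2) / (2 * (Real.exp 1 - 1))) ∧
    (∀ α : ℕ, adaptivityGap (InfluenceGraph.alphaBounded.{u} α) ≤
      ENNReal.ofReal
        ((Real.sqrt (4 * (Real.exp 1 - 1) ^ 2 * (α : ℝ) + (3 * Real.exp 1 - 2) ^ 2)
          + 3 * Real.exp 1 - 2) / (2 * (Real.exp 1 - 1)))) ∧
    ∃ C : ℝ, ∀ α : ℕ, adaptivityGap (InfluenceGraph.alphaBounded.{u} α) ≤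
      ENNReal.ofReal (Real.sqrt (α : ℝ) + C) := by
  simp only [← balancePoint_two_add_exp_div]
  refine ⟨fun α k hk => ⟨kAdaptivityGap_alphaBounded_le α (by omega),
    min_le_balancePoint_two_add_exp_div (by omega) α.cast_nonneg⟩,
    adaptivityGap_alphaBounded_le, ?_⟩
  have hc : 0 ≤ 2 + Real.exp 1 / (Real.exp 1 - 1) := by
    linarith [div_pos (Real.exp_pos 1) exp_one_sub_one_pos]
  exact ⟨_, fun α => (adaptivityGap_alphaBounded_le α).trans
    (ENNReal.ofReal_le_ofReal (balancePoint_le_sqrt_add α.cast_nonneg hc))⟩
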